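/- **Theorem 0.3 (Double cube theorem).** Let $\mathcal A$ be an abelian category and $S$ a finite set. Write $\mathcal P(S)$ for the power set of $S$, ordered by inclusion, and $[n]^S$ for the set of maps $S\to\{0,\dots,n\}$ with the pointwise order; identify $\mathcal P(S)$ with $[1]^S$ via characteristic functions $T\mapsto\chi_T$. An *$S$-cube* in $\mathcal A$ is a contravariant functor $y$ from $\mathcal P(S)$ to $\mathcal A$. Its *boundary morphisms* are $d^k_T=y(T\smallsetminus\{k\}\subset T)\colon y_T\to y_{T\smallsetminus\{k\}}$ for $k\in T\subset S$. For $k\in S$, the *frontside* and *backside $k$-faces* of $y$ are the $S\smallsetminus\{k\}$-cubes $U\mapsto y_U$ and $U\mapsto y_{U\cup\{k\}}$; the *faces* of $y$ are all its frontside and backside $k$-faces, $k\in S$. The *$k$-direction $0$-th homology* of $y$ is the $S\smallsetminus\{k\}$-cube $\mathrm H_0^k(y)$ with vertices $\mathrm H^k_0(y)_U=\operatorname{coker}(d^k_{U\cup\{k\}}\colon y_{U\cup\{k\}}\to y_U)$ and the induced morphisms. An $S$-cube $y$ is *admissible* if, inductively on $\# S$, all its boundary morphisms are monomorphisms and, for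 $\# S>1$, $\mathrm H_0^k(y)$ is admissible for every $k\in S$. (If $S=\emptyset$, every $S$-cube is admissible.) A *double $S$-cube* in $\mathcal A$ is a contravariant functor $x$ from $[2]^S$ to $\mathcal A$. Let $\mathbf 2\colon[1]^S\to[2]^S$ be the map $f\mapsto 2f$ and, for $T\subset S$, let $e_T\colon[1]^S\to[2]^S$ be the map $f\mapsto f+\chi_T$; both are order preserving, so $x\mathbf 2$ and $xe_T$ are $S$-cubes. Let $x$ be a double $S$-cube in $\mathcal A$ such that: 1. the $S$-cube $x\mathbf 2$ is admissible; 2. for all $\mathfrak j<\mathfrak j'$ in $[2]^S$, the morphism $x(\mathfrak j<\mathfrak j')$ is a monomorphism; 3. if $\# S\ge 3$, all faces of the $S$-cube $xe_T$ are admissible for every proper subset $T$ of $S$. Then the $S$-cube $xe_S$ is admissible. -/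

import Mathlib

open CategoryTheory CategoryTheory.Limits Opposite

universe w v u

namespace DoubleCube

/-- The set `[n]^S` of maps from `S` to `[n] = {0, ..., n}`. -/
def Grid (n : ℕ) (S : Type w) : Type w := S → Fin (n + 1)

/-- `[n]^S` is ordered pointwise. -/
instance (n : ℕ) (S : Type w) : PartialOrder (Grid n S) :=
  inferInstanceAs (PartialOrder (S → Fin (n + 1)))

/-- An `S`-cube in a category `D`: a contravariant functor from the power set of `S`,
ordered by inclusion (equivalently, from `[1]^S`, a subset corresponding to its
characteristic function). -/
abbrev Cube (S : Type w) (D : Type u) [Category.{v} D] := (Set S)ᵒᵖ ⥤ D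

/-- A double `S`-cube in a category `D`: a contravariant functor from `[2]^S`. -/
abbrev DCube (S : Type w) (D : Type u) [Category.{v} D] := (Grid 2 S)ᵒᵖ ⥤ D

section Maps

variable {S : Type w}

open Classical in
/-- The characteristic function of `T`, with values in `[2]`. -/
noncomputable def chi (T : Set S) (s : S) : Fin 3 := if s ∈ T then 1 else 0

/-- The order preserving map `𝟐 : [1]^S → [2]^S`, `f ↦ 2f`. -/
noncomputable def two : Set S →o Grid 2 S where
  toFun U := fun s => 2 * chi U s
  monotone' U V h s := by
    have := @h s
    by_cases hU : s ∈ U <;> by_cases hV : s ∈ V <;> simp_all [chi]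

/-- The order preserving map `e_T : [1]^S → [2]^S`, `f ↦ f + χ_T`. -/
noncomputable def e (T : Set S) : Set S →o Grid 2 S where
  toFun U := fun s => chi U s + chi T s
  monotone' U V h s := by
    have := @h s
    by_cases hU : s ∈ U <;> by_cases hV : s ∈ V <;> by_cases hT : s ∈ T <;>
      simp_all [chi]

/-- `F^k : P(S ∖ {k}) → P(S)`, `U ↦ U`. -/
def F (k : S) : Set {s : S // s ≠ k} →o Set S where
  toFun U := Subtype.val '' U
  monotone' _ _ h := Set.image_mono h

/-- `B^k : P(S ∖ {k}) → P(S)`, `U ↦ U ∪ {k}`. -/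
def B (k : S) : Set {s : S // s ≠ k} →o Set S where
  toFun U := Subtype.val '' U ∪ {k}
  monotone' _ _ h := Set.union_subset_union_left _ (Set.image_mono h)

theorem F_le_B (k : S) (U : Set {s : S // s ≠ k}) : F k U ≤ B k U :=
  Set.subset_union_left

end Maps

variable {S : Type w} {D : Type u} [Category.{v} D]

/-- The morphism `x(p ≤ q) : x_q ⟶ x_p` of a contravariant functor on a partially ordered set. -/
abbrev res {P : Type w} [PartialOrder P] (x : Pᵒᵖ ⥤ D) {p q : P} (h : p ≤ q) :
    x.obj (op q) ⟶ x.obj (op p) :=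
  x.map (homOfLE h).op

/-- The pull-back of a contravariant functor on a partially ordered set along an order preserving
map. -/
def pull {P Q : Type w} [PartialOrder P] [PartialOrder Q] (x : Qᵒᵖ ⥤ D) (f : P →o Q) :
    Pᵒᵖ ⥤ D where
  obj p := x.obj (op (f p.unop))
  map g := res x (f.monotone (leOfHom g.unop))
  map_id _ := x.map_id _
  map_comp _ _ := x.map_comp _ _

/-- The frontside `k`-face of `x`. -/
abbrev Cube.front (x : Cube S D) (k : S) : Cube {s : S // s ≠ k} D := pull x (F k)

/-- The backside `k`-face of `x`. -/
abbrev Cube.back (x : Cube S D) (k : S) : Cube {s : S // s ≠ k} D := pull x (B k)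

/-- The boundary morphism `d^k_T : x_T ⟶ x_{T ∖ {k}}` (of interest when `k ∈ T`). -/
def Cube.d (x : Cube S D) (T : Set S) (k : S) : x.obj (op T) ⟶ x.obj (op (T \ {k})) :=
  res x Set.sdiff_subset

/-- The morphism `d^k` from the backside to the frontside `k`-face, with components
`d^k_{T ∪ {k}} : x_{T ∪ {k}} ⟶ x_T` for `T ⊆ S ∖ {k}`. -/
def Cube.dFace (x : Cube S D) (k : S) : x.back k ⟶ x.front k where
  app T := res x (F_le_B k T.unop)
  naturality _ _ f := (x.map_comp _ _).symm.trans
    (x.map_comp (homOfLE (F_le_B k _)).op (homOfLE ((F k).monotone (leOfHom f.unop))).op)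

/-- The `k`-direction `0`-th homology of `x`: the `S ∖ {k}`-cube with vertices
`coker (d^k_{T ∪ {k}} : x_{T ∪ {k}} ⟶ x_T)` and the induced morphisms. -/
noncomputable def Cube.H0 [Abelian D] (x : Cube S D) (k : S) : Cube {s : S // s ≠ k} D where
  obj T := cokernel ((x.dFace k).app T)
  map {T T'} f := cokernel.map ((x.dFace k).app T) ((x.dFace k).app T')
    ((x.back k).map f) ((x.front k).map f) ((x.dFace k).naturality f).symm
  map_id T := by
    rw [← cancel_epi (cokernel.π _)]
    simp [cokernel.map]
  map_comp f g := by
    rw [← cancel_epi (cokernel.π _)]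
    simp [cokernel.map]

/-- Admissible cubes, for finite `S`: all boundary morphisms are monomorphisms, and all the
`S ∖ {k}`-cubes `H_0^k(x)` are admissible. For empty `S` there is no condition, hence for
`#S = 1` the only condition is that the unique boundary morphism is a monomorphism. -/
inductive Cube.Admissible [Abelian D] : ∀ {S : Type w}, Cube S D → Prop
  | intro {S : Type w} (x : Cube S D)
      (mono_d : ∀ (T : Set S) (k : S), k ∈ T → Mono (x.d T k))
      (adm_H0 : ∀ k : S, Cube.Admissible (x.H0 k)) : Cube.Admissible x

end DoubleCube

/-! The vertices of `x` embed into the vertex at `0`, so the argument takes place in the modular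
lattice of its subobjects. A cube of subobjects `P` is admissible iff each direction `i` stays
injective modulo any set `L` of other directions, at every vertex `U` avoiding these directions;
this is the lattice inequality of `Presentation.admissible_iff`.

For a square the inequality says that the square is cartesian, which is symmetric in the two
directions. The modular law gives the same symmetry relative to further directions
(`Transverse.swap`). So, once boxes of lower dimension are known, one direction of a box implies all
others (`Transverse.erase_of_erase`), and a box may be cut or enlarged along an edge of choice
(`Transverse.glue`, `Transverse.shrink`).

Boxes with unit edges and a fixed coordinate equal to 1 lie in backside faces of some `x e_T` with
`T` proper; gluing yields those with longer edges. A box of `x e_S` has edges from 1 to 2. An edge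
is stretched to run from 0 to 2; the exchange of directions then needs only the box without that
edge, where 1 is a fixed coordinate. When all edges are stretched, the box either has a fixed
coordinate 1 or lies in `x 𝟐`. -/

namespace DoubleCube

/-! ### Modularity of subobject lattices in an abelian category. -/

section Subobjects

variable {A : Type u} [Category.{v} A] [Abelian A] {X : A}

theorem factors_of_epi_comp (P : Subobject X) {T T' : A} (π : T' ⟶ T) [Epi π] (f : T ⟶ X)
    (h : P.Factors (π ≫ f)) : P.Factors f := by
  have sq : CommSq (P.factorThru _ h) π P.arrow f := ⟨by simp⟩
  have := strongEpi_of_epi π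
  have : sq.HasLift := inferInstance
  rw [← sq.fac_right]
  exact Subobject.factors_comp_arrow _

/-- Generalized elements of a sum split as sums after an epimorphic refinement, because the
biproduct maps onto the image. This permits element-style proofs. -/
theorem sup_factors_iff (P Q : Subobject X) {T : A} (f : T ⟶ X) :
    (P ⊔ Q).Factors f ↔ ∃ (T' : A) (π : T' ⟶ T) (_ : Epi π) (a b : T' ⟶ X),
      P.Factors a ∧ Q.Factors b ∧ π ≫ f = a + b := by
  constructor
  · intro h
    let σ : (P : A) ⊞ (Q : A) ⟶ X := biprod.desc P.arrow Q.arrow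
    have hP : P ≤ imageSubobject σ := Subobject.le_of_comm
      (biprod.inl ≫ factorThruImageSubobject σ) (by simp [σ])
    have hQ : Q ≤ imageSubobject σ := Subobject.le_of_comm
      (biprod.inr ≫ factorThruImageSubobject σ) (by simp [σ])
    have h' := Subobject.factors_of_le f (sup_le hP hQ) h
    obtain ⟨T', π, hπ, t, ht⟩ := surjective_up_to_refinements_of_epi
      (factorThruImageSubobject σ) (Subobject.factorThru _ f h')
    refine ⟨T', π, hπ, (t ≫ biprod.fst) ≫ P.arrow, (t ≫ biprod.snd) ≫ Q.arrow,
      Subobject.factors_comp_arrow _, Subobject.factors_comp_arrow _, ?_⟩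
    have := ht =≫ (imageSubobject σ).arrow
    simp only [Category.assoc, Subobject.factorThru_arrow, imageSubobject_arrow_comp] at this
    rw [this]
    simp [σ, biprod.desc_eq]
  · rintro ⟨T', π, hπ, a, b, ha, hb, h⟩
    apply factors_of_epi_comp _ π
    rw [h]
    exact Subobject.factors_add _ _ (Subobject.sup_factors_of_factors_left ha)
      (Subobject.sup_factors_of_factors_right hb)

instance subobject_isModularLattice : IsModularLattice (Subobject X) where
  sup_inf_le_assoc_of_le := by
    intro P Q R hPR
    apply Subobject.le_of_factors
    have hf := Subobject.factors_self ((P ⊔ Q) ⊓ R)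
    generalize ((P ⊔ Q) ⊓ R).arrow = f at hf
    rw [Subobject.inf_factors, sup_factors_iff] at hf
    obtain ⟨⟨T, π, hπ, a, b, ha, hb, h⟩, hR⟩ := hf
    rw [sup_factors_iff]
    refine ⟨T, π, hπ, a, b, ha, ?_, h⟩
    rw [Subobject.inf_factors]
    refine ⟨hb, Subobject.factors_right_of_factors_add a b ?_ (Subobject.factors_of_le _ hPR ha)⟩
    rw [← h]
    exact Subobject.factors_of_factors_right _ hR

end Subobjects

/-! ### Cubes of subquotients and their homology. -/

section Presentation

variable {A : Type u} [Category.{v} A] [Abelian A]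

/-- The projection of a vertex of the frontside `k`-face onto the `0`-th homology. -/
noncomputable def Cube.toH0 {S : Type w} (y : Cube S A) (k : S) (U : Set {s : S // s ≠ k}) :
    y.obj (op (F k U)) ⟶ (y.H0 k).obj (op U) :=
  cokernel.π ((y.dFace k).app (op U))

instance Cube.epi_toH0 {S : Type w} (y : Cube S A) (k : S) (U : Set {s : S // s ≠ k}) :
    Epi (y.toH0 k U) :=
  inferInstanceAs (Epi (cokernel.π ((y.dFace k).app (op U))))

theorem Cube.res_toH0 {S : Type w} (y : Cube S A) (k : S) {U V : Set {s : S // s ≠ k}}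
    (h : U ≤ V) (h' : F k U ≤ F k V) :
    res y h' ≫ y.toH0 k U = y.toH0 k V ≫ res (y.H0 k) h :=
  (cokernel.π_desc _ _ _).symm

theorem Cube.comp_toH0_eq_zero_iff {S : Type w} (y : Cube S A) (k : S)
    (U : Set {s : S // s ≠ k}) {T : A} (t : T ⟶ y.obj (op (F k U))) :
    t ≫ y.toH0 k U = 0 ↔ ∃ (T' : A) (σ : T' ⟶ T) (_ : Epi σ) (s : T' ⟶ y.obj (op (B k U))),
      σ ≫ t = s ≫ res y (F_le_B k U) :=
  CokernelCofork.IsColimit.comp_π_eq_zero_iff_up_to_refinements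
    (cokernelIsCokernel ((y.dFace k).app (op U))) t

/-- A presentation of the cube `y` by subquotients of `X`: the vertex `y_U` is the quotient of
`P U` by its intersection with `Q U`, compatibly with the morphisms of `y`. -/
structure Presentation {S : Type w} (y : Cube S A) {X : A} (P Q : Set S → Subobject X) where
  π : ∀ U, (P U : A) ⟶ y.obj (op U)
  epi : ∀ U, Epi (π U)
  le : ∀ {U V : Set S}, U ≤ V → P V ≤ P U
  comm : ∀ {U V : Set S} (h : U ≤ V), Subobject.ofLE _ _ (le h) ≫ π U = π V ≫ res y h
  ker : ∀ (U : Set S) {T : A} (t : T ⟶ (P U : A)), t ≫ π U = 0 ↔ (Q U).Factors (t ≫ (P U).arrow)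

namespace Presentation

variable {S : Type w} {y : Cube S A} {X : A} {P Q : Set S → Subobject X}

/-- The kernel of the induced map of quotients is `P V ⊓ Q U` modulo `P V ⊓ Q V`. -/
theorem mono_res_iff (ρ : Presentation y P Q) {U V : Set S} (h : U ≤ V) :
    Mono (res y h) ↔ P V ⊓ Q U ≤ Q V := by
  constructor
  · intro _
    apply Subobject.le_of_factors
    have hf := Subobject.factors_self (P V ⊓ Q U)
    generalize (P V ⊓ Q U).arrow = f at hf
    rw [Subobject.inf_factors] at hf
    obtain ⟨hP, hQ⟩ := hf
    have : (P V).factorThru f hP ≫ ρ.π V = 0 := by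
      rw [← cancel_mono (res y h), Category.assoc, ← ρ.comm h, zero_comp, ← Category.assoc, ρ.ker]
      simpa using hQ
    simpa using (ρ.ker V _).1 this
  · intro hle
    apply Preadditive.mono_of_cancel_zero
    intro T t ht
    have := ρ.epi V
    obtain ⟨T', σ, hσ, s, hs⟩ := surjective_up_to_refinements_of_epi (ρ.π V) t
    rw [← cancel_epi σ, comp_zero, hs, ρ.ker]
    apply Subobject.factors_of_le _ hle
    rw [Subobject.inf_factors]
    refine ⟨Subobject.factors_comp_arrow _, ?_⟩
    have h0 : (s ≫ Subobject.ofLE _ _ (ρ.le h)) ≫ ρ.π U = 0 := by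
      rw [Category.assoc, ρ.comm h, ← Category.assoc, ← hs, Category.assoc, ht, comp_zero]
    simpa using (ρ.ker U _).1 h0

/-- The presentation of the `k`-direction `0`-th homology. -/
noncomputable def H0 (ρ : Presentation y P Q) (k : S) :
    Presentation (y.H0 k) (fun U => P (F k U)) (fun U => P (B k U) ⊔ Q (F k U)) where
  π U := ρ.π (F k U) ≫ y.toH0 k U
  epi U := by
    have := ρ.epi (F k U)
    exact epi_comp _ _
  le h := ρ.le ((F k).monotone h)
  comm {U V} h := by
    rw [← Category.assoc, ρ.comm ((F k).monotone h), Category.assoc, Category.assoc,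
      y.res_toH0 k h]
  ker U T t := by
    rw [sup_factors_iff]
    constructor
    · intro h
      rw [← Category.assoc, y.comp_toH0_eq_zero_iff] at h
      obtain ⟨T₁, σ₁, _, s, hs⟩ := h
      have := ρ.epi (B k U)
      obtain ⟨T₂, σ₂, _, r, hr⟩ := surjective_up_to_refinements_of_epi (ρ.π (B k U)) s
      refine ⟨T₂, σ₂ ≫ σ₁, epi_comp _ _, r ≫ (P (B k U)).arrow,
        ((σ₂ ≫ σ₁) ≫ t - r ≫ Subobject.ofLE _ _ (ρ.le (F_le_B k U))) ≫ (P (F k U)).arrow,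
        Subobject.factors_comp_arrow _, ?_, by simp⟩
      rw [← ρ.ker, Preadditive.sub_comp, sub_eq_zero]
      rw [Category.assoc r, ρ.comm (F_le_B k U), ← Category.assoc r, ← hr, Category.assoc σ₂ s,
        ← hs]
      simp only [Category.assoc]
    · rintro ⟨T', σ, _, a, b, ha, hb, h⟩
      have hPb : (P (F k U)).Factors b := by
        refine Subobject.factors_right_of_factors_add a b ?_
          (Subobject.factors_of_le _ (ρ.le (F_le_B k U)) ha)
        rw [← h, ← Category.assoc]
        exact Subobject.factors_comp_arrow _
      have hb0 : (P (F k U)).factorThru b hPb ≫ ρ.π (F k U) = 0 := by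
        rw [ρ.ker]
        simpa using hb
      have ht : σ ≫ t = (P (B k U)).factorThru a ha ≫ Subobject.ofLE _ _ (ρ.le (F_le_B k U)) +
          (P (F k U)).factorThru b hPb := by
        rw [← cancel_mono (P (F k U)).arrow]
        simpa using h
      rw [← Category.assoc, y.comp_toH0_eq_zero_iff]
      refine ⟨T', σ, inferInstance, (P (B k U)).factorThru a ha ≫ ρ.π (B k U), ?_⟩
      rw [← Category.assoc, ht, Preadditive.add_comp, hb0, add_zero, Category.assoc,
        ρ.comm (F_le_B k U), Category.assoc]

end Presentation

end Presentation

/-! ### Admissibility as a family of lattice inequalities. -/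

section Admissible

variable {A : Type u} [Category.{v} A]

theorem Cube.admissible_iff_mono_H0 {S : Type w} [Abelian A] (y : Cube S A) :
    y.Admissible ↔ (∀ (T : Set S) (k : S), k ∈ T → Mono (y.d T k)) ∧
      ∀ k : S, (y.H0 k).Admissible :=
  ⟨fun h => by cases h with | intro _ h₁ h₂ => exact ⟨h₁, h₂⟩, fun h => .intro _ h.1 h.2⟩

open Classical in
-- Iterated homology shrinks the index type, so the original directions `S₀` are kept fixed: `ι`
-- embeds the remaining ones and `K` collects those already divided out. Induction on the number of
-- remaining directions.
theorem Presentation.admissible_iff_of_image [Abelian A] {S₀ : Type w} {X : A} (P : Set S₀ → Subobject X) :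
    ∀ (n : ℕ) {S : Type w} [Finite S] (_ : Nat.card S = n) (y : Cube S A) (ι : S → S₀)
      (_ : Function.Injective ι) (K : Finset S₀) (_ : ∀ s, ι s ∉ K)
      (_ : Presentation y (fun U => P (ι '' U)) (fun U => K.sup fun k => P (insert k (ι '' U)))),
      y.Admissible ↔ ∀ (L : Finset S₀) (i : S) (U : Set S), K ⊆ L → ι i ∉ L →
        (∀ k ∈ L, k ∈ K ∨ k ∈ Set.range ι) → (∀ u ∈ U, ι u ∉ L) → i ∉ U →
        P (ι '' insert i U) ⊓ L.sup (fun k => P (insert k (ι '' U))) ≤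
          L.sup (fun k => P (insert k (ι '' insert i U))) := by
  intro n
  induction n with
  | zero =>
    intro S _ hn y ι _ K _ _
    have : IsEmpty S := (Finite.card_eq_zero_iff).1 hn
    rw [Cube.admissible_iff_mono_H0]
    exact ⟨fun _ _ i => isEmptyElim i, fun _ => ⟨fun _ k => isEmptyElim k, fun k => isEmptyElim k⟩⟩
  | succ n ih =>
    intro S _ hn y ι hι K hK ρ
    have hH : ∀ k : S, (y.H0 k).Admissible ↔ _ := fun k =>
      ih (S := {s : S // s ≠ k}) (by
        have := Fintype.ofFinite S
        rw [Nat.card_eq_fintype_card] at hn ⊢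
        simp [Fintype.card_subtype_compl, hn]) (y.H0 k) (ι ∘ Subtype.val)
        (hι.comp Subtype.val_injective) (insert (ι k) K) (by
          intro s
          simp only [Function.comp, Finset.mem_insert, not_or]
          exact ⟨fun h => s.2 (hι h), hK s⟩) (by
          have h := ρ.H0 k
          simp only [Finset.sup_insert, Set.image_comp]
          simpa [F, B, Set.image_insert_eq] using h)
    have hm : (∀ (T : Set S) (k : S), k ∈ T → Mono (y.d T k)) ↔ ∀ (U : Set S) (i : S), i ∉ U →
        P (ι '' insert i U) ⊓ K.sup (fun k => P (insert k (ι '' U))) ≤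
          K.sup (fun k => P (insert k (ι '' insert i U))) := by
      constructor
      · intro h U i hi
        have := h (insert i U) i (Set.mem_insert _ _)
        rw [Cube.d, ρ.mono_res_iff] at this
        simpa [hi] using this
      · intro h T k hk
        rw [Cube.d, ρ.mono_res_iff]
        have := h (T \ {k}) k (by simp)
        simpa [Set.insert_eq_of_mem hk] using this
    rw [Cube.admissible_iff_mono_H0, hm]
    constructor
    · rintro ⟨h₁, h₂⟩ L i U hKL hi hL hU hiU
      -- For `L = K` the inequality is injectivity of a boundary morphism; otherwise some direction
      -- of `L` outside `K` is divided out next.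
      by_cases hLK : L ⊆ K
      · obtain rfl := Finset.Subset.antisymm hLK hKL
        exact h₁ U i hiU
      · obtain ⟨l, hl, hlK⟩ := Finset.not_subset.1 hLK
        obtain ⟨k, rfl⟩ := (hL l hl).resolve_left hlK
        have hne : ∀ {u}, ι u ∉ L → u ≠ k := fun h e => h (e ▸ hl)
        have hVU : Subtype.val '' {v : {s : S // s ≠ k} | v.1 ∈ U} = U := by
          ext u
          simp only [Set.mem_image, Set.mem_ofPred_eq, Subtype.exists, exists_and_left, exists_prop,
            exists_eq_right_right, and_iff_left_iff_imp]
          exact fun hu => hne (hU u hu)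
        have := (hH k).1 (h₂ k) L ⟨i, hne hi⟩ {v | v.1 ∈ U} (Finset.insert_subset hl hKL) hi
          (fun l' hl' => by
            by_cases e : l' = ι k
            · exact .inl (by simp [e])
            · rcases hL l' hl' with h | ⟨s, rfl⟩
              · exact .inl (by simp [h])
              · exact .inr ⟨⟨s, fun h => e (h ▸ rfl)⟩, rfl⟩)
          (fun u hu => hU u.1 hu) hiU
        simp only [Set.image_comp, Set.image_insert_eq, hVU] at this ⊢
        exact this
    · intro h
      refine ⟨fun U i hi => ?_, fun k => (hH k).2 fun L i U hKL hi hL hU hiU => ?_⟩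
      · exact h K i U subset_rfl (hK i) (fun k hk => .inl hk) (fun u _ => hK u) hi
      · have := h L i.1 (Subtype.val '' U) ((Finset.subset_insert _ _).trans hKL) hi
          (fun l hl => by
            rcases hL l hl with h | ⟨s, rfl⟩
            · rcases Finset.mem_insert.1 h with rfl | h
              · exact .inr ⟨k, rfl⟩
              · exact .inl h
            · exact .inr ⟨s.1, rfl⟩)
          (by rintro _ ⟨u, hu, rfl⟩; exact hU u hu)
          (by rintro ⟨u, hu, e⟩; exact hiU (Subtype.ext e ▸ hu))
        simp only [Set.image_comp, Set.image_insert_eq] at this ⊢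
        exact this

open Classical in
theorem Presentation.admissible_iff [Abelian A] {S : Type w} [Finite S] {X : A} {y : Cube S A}
    {P : Set S → Subobject X} (ρ : Presentation y P (fun _ => ⊥)) :
    y.Admissible ↔ ∀ (L : Finset S) (i : S) (U : Set S), i ∉ L → (∀ u ∈ U, u ∉ L) → i ∉ U →
      P (insert i U) ⊓ L.sup (fun k => P (insert k U)) ≤
        L.sup (fun k => P (insert k (insert i U))) := by
  rw [Presentation.admissible_iff_of_image P _ rfl y id Function.injective_id ∅ (by simp)
    (by simpa using ρ)]
  simp

/-! ### Double cubes as families of subobjects of the vertex at `0`. -/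

section DCube

variable {S : Type w}

/-- The least element of `[n]^S`. -/
def Grid.zero (n : ℕ) (S : Type w) : Grid n S := fun _ => 0

theorem Grid.zero_le {n : ℕ} (j : Grid n S) : Grid.zero n S ≤ j :=
  fun _ => Fin.zero_le _

theorem res_comp {P : Type w} [PartialOrder P] (x : Pᵒᵖ ⥤ A)
    {p q r : P} (h : p ≤ q) (h' : q ≤ r) : res x h' ≫ res x h = res x (h.trans h') :=
  (x.map_comp _ _).symm

/-- The vertices of a double cube of monomorphisms, as subobjects of the vertex at `0`. -/
noncomputable def DCube.vertex (x : DCube S A)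
    (hx : ∀ j : Grid 2 S, Mono (res x (Grid.zero_le j))) (j : Grid 2 S) :
    Subobject (x.obj (op (Grid.zero 2 S))) :=
  Subobject.mk (res x (Grid.zero_le j))

variable (x : DCube S A) (hx : ∀ j : Grid 2 S, Mono (res x (Grid.zero_le j)))

theorem DCube.vertex_antitone : Antitone (x.vertex hx) :=
  fun _ _ h => Subobject.mk_le_mk_of_comm (res x h) (res_comp x _ _)

/-- The object underlying a vertex of a double cube of monomorphisms. -/
noncomputable def DCube.vertexIso (j : Grid 2 S) : (x.vertex hx j : A) ≅ x.obj (op j) :=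
  Subobject.underlyingIso (res x (Grid.zero_le j))

theorem DCube.vertexIso_hom_res (j : Grid 2 S) :
    (x.vertexIso hx j).hom ≫ res x (Grid.zero_le j) = (x.vertex hx j).arrow :=
  Subobject.underlyingIso_hom_comp_eq_mk _

theorem DCube.ofLE_vertexIso_hom {j j' : Grid 2 S} (h : j ≤ j') :
    Subobject.ofLE _ _ (x.vertex_antitone hx h) ≫ (x.vertexIso hx j).hom =
      (x.vertexIso hx j').hom ≫ res x h := by
  have := hx j
  rw [← cancel_mono (res x (Grid.zero_le j)), Category.assoc, Category.assoc, res_comp,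
    vertexIso_hom_res, vertexIso_hom_res, Subobject.ofLE_arrow]

/-- A cube of vertices of a double cube of monomorphisms is presented by these vertices. -/
noncomputable def DCube.presentation [Abelian A] {S' : Type w} (φ : Set S' →o Grid 2 S) :
    Presentation (pull x φ) (fun U => x.vertex hx (φ U)) (fun _ => ⊥) where
  π U := (x.vertexIso hx (φ U)).hom
  epi U := inferInstanceAs (Epi (x.vertexIso hx (φ U)).hom)
  le h := x.vertex_antitone hx (φ.monotone h)
  comm h := x.ofLE_vertexIso_hom hx (φ.monotone h)
  ker U T t := by
    rw [Subobject.bot_factors_iff_zero]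
    exact (Preadditive.IsIso.comp_right_eq_zero t (x.vertexIso hx (φ U)).hom).trans
      ⟨fun h => by rw [h, zero_comp], fun h => zero_of_comp_mono _ h⟩

end DCube

end Admissible

/-! ### Combinatorics of boxes in a modular lattice. -/

section Lattice

open Function Classical

variable {S : Type w} {L : Type*} [Lattice L] [OrderBot L] {Z : (S → Fin 3) → L}

/-- The lattice condition on the cube spanned by `p` and by the points obtained from `p` by
replacing one coordinate `p k`, `k ∈ insert i K`, by `q k`, which expresses that its `i`-direction
boundary morphism is injective modulo the directions in `K`. -/
def Transverse (Z : (S → Fin 3) → L) (p q : S → Fin 3) (i : S) (K : Finset S) : Prop :=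
  Z (update p i (q i)) ⊓ K.sup (fun k => Z (update p k (q k))) ≤
    K.sup (fun k => Z (update (update p i (q i)) k (q k)))

theorem update_le_update_update {p q : S → Fin 3} {i k : S} (hik : i ≠ k) (hi : p i ≤ q i) :
    update p k (q k) ≤ update (update p i (q i)) k (q k) := by
  rw [update_comm hik]
  exact le_update_iff.2 ⟨by simpa [hik] using hi, fun _ _ => le_rfl⟩

/-- Modulo `K`, the hypothesis `h` makes the square in directions `i`, `j` cartesian, hence usable
in the other direction; `h'` removes the error term lying in `b`. -/
theorem Transverse.swap [IsModularLattice L] (hZ : Antitone Z) {p q : S → Fin 3} {i j : S}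
    {K : Finset S} (hij : i ≠ j) (hK : i ∉ K) (hi : p i ≤ q i)
    (h : Transverse Z p q i (insert j K)) (h' : Transverse Z p q j K) :
    Transverse Z p q j (insert i K) := by
  unfold Transverse at *
  simp only [Finset.sup_insert] at *
  have hj := hZ (update_le_update_update hij hi)
  rw [update_comm hij] at h hj
  set yi := Z (update p i (q i))
  set yj := Z (update p j (q j))
  set yij := Z (update (update p j (q j)) i (q i))
  set b := K.sup fun k => Z (update p k (q k))
  set bi := K.sup fun k => Z (update (update p i (q i)) k (q k))
  set bj := K.sup fun k => Z (update (update p j (q j)) k (q k))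
  have hbi : bi ≤ b := Finset.sup_mono_fun fun k hk =>
    hZ (update_le_update_update (fun e => hK (e ▸ hk)) hi)
  have h1 : yj ⊓ (yi ⊔ b) ≤ b ⊔ yij := calc
    yj ⊓ (yi ⊔ b) ≤ (b ⊔ yi) ⊓ (yj ⊔ b) :=
      le_inf (inf_le_right.trans (sup_comm _ _).le) (inf_le_left.trans le_sup_left)
    _ ≤ b ⊔ yi ⊓ (yj ⊔ b) := (sup_inf_assoc_of_le yi le_sup_right).le
    _ ≤ b ⊔ yij := sup_le le_sup_left (h.trans (sup_le le_sup_right (hbi.trans le_sup_left)))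
  -- Second use of modularity, now through `yij ≤ yj`.
  calc yj ⊓ (yi ⊔ b) ≤ (yij ⊔ b) ⊓ yj := le_inf (h1.trans (sup_comm _ _).le) inf_le_left
    _ ≤ yij ⊔ b ⊓ yj := (sup_inf_assoc_of_le b hj).le
    _ ≤ yij ⊔ bj := sup_le_sup_left ((inf_comm _ _).le.trans h') _

theorem Transverse.erase_of_erase [IsModularLattice L] (hZ : Antitone Z) {p q : S → Fin 3} {i j : S}
    {M : Finset S} (hi : i ∈ M) (hj : j ∈ M) (hpq : p i ≤ q i)
    (h : Transverse Z p q i (M.erase i)) (h' : i ≠ j → Transverse Z p q j ((M.erase i).erase j)) :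
    Transverse Z p q j (M.erase j) := by
  rcases eq_or_ne i j with rfl | hij
  · exact h
  · have := Transverse.swap hZ (K := (M.erase i).erase j) hij (by simp) hpq
      (by rwa [Finset.insert_erase (by simp [hij.symm, hj])]) (h' hij)
    rwa [Finset.erase_right_comm, Finset.insert_erase (by simp [hij, hi])] at this

/-- Raising the start of edge `i` only shrinks the supremum on the left; all other terms depend on
`q i` alone. If a composite is injective, so is its first factor. -/
theorem Transverse.shrink (hZ : Antitone Z) {p q : S → Fin 3} {i : S} {K : Finset S} (hK : i ∉ K)
    {c : Fin 3} (hc : p i ≤ c) (h : Transverse Z p q i K) :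
    Transverse Z (update p i c) q i K := by
  unfold Transverse at *
  rw [update_idem]
  refine le_trans (inf_le_inf_left _ (Finset.sup_mono_fun fun k hk => hZ ?_)) h
  have hik : i ≠ k := fun e => hK (e ▸ hk)
  have := update_le_update_update (q := update q i c) hik (by simpa using hc)
  simpa [hik.symm] using this

/-- A composite of injective maps is injective. -/
theorem Transverse.glue (hZ : Antitone Z) {p q : S → Fin 3} {i : S} {K : Finset S} (hK : i ∉ K)
    {c : Fin 3} (hc : c ≤ q i) (h : Transverse Z p (update q i c) i K)
    (h' : Transverse Z (update p i c) q i K) : Transverse Z p q i K := by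
  unfold Transverse at *
  rw [update_idem] at h'
  have e : ∀ k ∈ K, update q i c k = q k := fun k hk =>
    update_of_ne (ne_of_mem_of_not_mem hk hK) _ _
  have e₁ := Finset.sup_congr rfl fun k hk => congrArg (fun a => Z (update p k a)) (e k hk)
  have e₂ := Finset.sup_congr rfl fun k hk =>
    congrArg (fun a => Z (update (update p i c) k a)) (e k hk)
  rw [update_self, e₁, e₂] at h
  exact le_trans (le_inf inf_le_left (le_trans (inf_le_inf_right _
    (hZ (update_le_update_iff.2 ⟨hc, fun _ _ => le_rfl⟩))) h)) h'

/-- Cubes of long edges are glued from cubes of short edges. -/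
theorem transverse_of_short [IsModularLattice L] (hZ : Antitone Z)
    (hs : ∀ (p q : S → Fin 3) (M : Finset S) (i : S), i ∈ M → (∃ j, j ∉ M ∧ p j = 1) →
      (∀ k ∈ M, (q k : ℕ) = p k + 1) → Transverse Z p q i (M.erase i))
    (p q : S → Fin 3) (M : Finset S) (i : S) (hi : i ∈ M) (hj : ∃ j, j ∉ M ∧ p j = 1)
    (hpq : ∀ k ∈ M, p k < q k) : Transverse Z p q i (M.erase i) := by
  induction hn : ∑ k ∈ M, ((q k : ℕ) - p k) using Nat.strong_induction_on
    generalizing p q M i with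
  | _ n ih =>
    by_cases hshort : ∀ k ∈ M, (q k : ℕ) = p k + 1
    · exact hs p q M i hi hj hshort
    · push Not at hshort
      obtain ⟨k, hk, hqk⟩ := hshort
      have hlt : (p k : ℕ) < q k := hpq k hk
      have hp0 : p k = 0 := by omega
      have hq2 : q k = 2 := by omega
      refine Transverse.erase_of_erase hZ hk hi (hpq k hk).le ?_ fun hki => ?_
      -- The edge `k` runs from 0 to 2 and is cut at 1; both halves have smaller total edge length.
      · refine Transverse.glue hZ (c := 1) (by simp) (by simp [hq2]) ?_ ?_
        · refine ih _ ?_ p _ M k hk hj (fun l hl => ?_) rfl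
          · rw [← hn]
            refine Finset.sum_lt_sum (fun l _ => ?_) ⟨k, hk, by simp [hq2, hp0]⟩
            rcases eq_or_ne l k with rfl | h <;> simp [*]
          · rcases eq_or_ne l k with rfl | h
            · simp [hp0]
            · simpa [h] using hpq l hl
        · obtain ⟨j, hjM, hpj⟩ := hj
          refine ih _ ?_ _ q M k hk
            ⟨j, hjM, by rwa [update_of_ne (ne_of_mem_of_not_mem hk hjM).symm]⟩ (fun l hl => ?_) rfl
          · rw [← hn]
            refine Finset.sum_lt_sum (fun l _ => ?_) ⟨k, hk, by simp [hq2, hp0]⟩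
            rcases eq_or_ne l k with rfl | h <;> simp [*]
          · rcases eq_or_ne l k with rfl | h
            · simp [hq2]
            · simpa [h] using hpq l hl
      · refine ih _ ?_ p q (M.erase k) i (by simp [hki.symm, hi]) ?_
          (fun l hl => hpq l (Finset.mem_of_mem_erase hl)) rfl
        · rw [← hn, ← Finset.sum_erase_add _ _ hk]
          omega
        · obtain ⟨j, hjM, hpj⟩ := hj
          exact ⟨j, fun h => hjM (Finset.mem_of_mem_erase h), hpj⟩

/-- The lattice form of the double cube theorem. -/
theorem transverse_of_two [IsModularLattice L] (hZ : Antitone Z)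
    (hs : ∀ (p q : S → Fin 3) (M : Finset S) (i : S), i ∈ M → (∃ j, j ∉ M ∧ p j = 1) →
      (∀ k ∈ M, (q k : ℕ) = p k + 1) → Transverse Z p q i (M.erase i))
    (ht : ∀ (p q : S → Fin 3) (M : Finset S) (i : S), i ∈ M → (∀ j, j ∉ M → p j ≠ 1) →
      (∀ k ∈ M, p k = 0) → (∀ k ∈ M, q k = 2) → Transverse Z p q i (M.erase i))
    (p q : S → Fin 3) (M : Finset S) (i : S) (hi : i ∈ M) (hp : ∀ k ∈ M, p k ≠ 2)
    (hq : ∀ k ∈ M, q k = 2) : Transverse Z p q i (M.erase i) := by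
  induction hn : ∑ k ∈ M, ((p k : ℕ) + 1) using Nat.strong_induction_on
    generalizing p M i with
  | _ n ih =>
    have hpq : ∀ k ∈ M, p k < q k := fun k hk => by have := hp k hk; have := hq k hk; omega
    by_cases hj : ∃ j, j ∉ M ∧ p j = 1
    · exact transverse_of_short hZ hs p q M i hi hj hpq
    by_cases h0 : ∀ k ∈ M, p k = 0
    · exact ht p q M i hi (fun j hjM hpj => hj ⟨j, hjM, hpj⟩) h0 hq
    push Not at h0
    obtain ⟨k, hk, hpk⟩ := h0
    refine Transverse.erase_of_erase hZ hk hi (hpq k hk).le ?_ fun hki => ?_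
    -- The edge `k` starts at 1; it is stretched to start at 0, which lowers the induction measure.
    · have := Transverse.shrink hZ (p := update p k 0) (q := q) (K := M.erase k) (c := p k)
        (i := k) (by simp) (by simp) (ih _ ?_ _ M k hk (fun l hl => ?_) hq rfl)
      · simpa using this
      · rw [← hn]
        refine Finset.sum_lt_sum (fun l _ => ?_) ⟨k, hk, ?_⟩
        · rcases eq_or_ne l k with rfl | h <;> simp [*]
        · simp only [update_self, Fin.val_zero]
          omega
      · rcases eq_or_ne l k with rfl | h
        · simp
        · simpa [h] using hp l hl
    -- Without the edge `k`, the value `p k = 1` becomes a fixed coordinate.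
    · refine ih _ ?_ p (M.erase k) i (by simp [hki.symm, hi])
        (fun l hl => hp l (Finset.mem_of_mem_erase hl))
        (fun l hl => hq l (Finset.mem_of_mem_erase hl)) rfl
      rw [← hn, ← Finset.sum_erase_add _ _ hk]
      omega

end Lattice

/-! ### Coordinates of the embeddings `two` and `e T`. -/

section Grid

open Function

variable {S : Type w}

open Classical in
theorem chi_congr {U V : Set S} {s : S} (h : s ∈ U ↔ s ∈ V) : chi U s = chi V s :=
  if_congr h rfl rfl

theorem two_apply (U : Set S) (s : S) : two U s = 2 * chi U s := rfl

theorem e_apply (T U : Set S) (s : S) : e T U s = chi U s + chi T s := rfl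

theorem two_insert [DecidableEq S] (U : Set S) (k : S) :
    two (insert k U) = update (two U : S → Fin 3) k 2 := by
  funext s
  refine Eq.trans ?_ (update_apply (two U : S → Fin 3) k 2 s).symm
  rw [two_apply, two_apply]
  rcases eq_or_ne s k with rfl | hs
  · simp [chi]
  · have : s ∈ insert k U ↔ s ∈ U := by simp [hs]
    have : chi (insert k U) s = chi U s := chi_congr this
    rw [this, if_neg hs]

theorem two_setOf_eq_two {p : S → Fin 3} (hp : ∀ s, p s ≠ 1) : two {s | p s = 2} = p := by
  funext s
  have := hp s
  rw [two_apply]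
  by_cases hs : p s = 2
  · simp [chi, hs]
  · simp only [chi, Set.mem_ofPred_eq, hs, if_false, mul_zero]
    have : (p s : ℕ) ≠ 1 := fun h => this (Fin.ext h)
    have : (p s : ℕ) ≠ 2 := fun h => hs (Fin.ext h)
    exact Fin.ext (by simp; omega)

theorem e_apply_insert [DecidableEq S] (T U : Set S) {k : S} {c : Fin 3} (hc : 1 + chi T k = c) :
    e T (insert k U) = update (e T U : S → Fin 3) k c := by
  funext s
  refine Eq.trans ?_ (update_apply (e T U : S → Fin 3) k c s).symm
  rw [e_apply, e_apply, ← hc]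
  rcases eq_or_ne s k with rfl | hs
  · simp [chi]
  · have : s ∈ insert k U ↔ s ∈ U := by simp [hs]
    have : chi (insert k U) s = chi U s := chi_congr this
    rw [this, if_neg hs]

theorem B_insert (j : S) (U : Set {s : S // s ≠ j}) (k : {s : S // s ≠ j}) :
    B j (insert k U) = insert k.1 (B j U) := by
  simp [B, Set.image_insert_eq, Set.insert_comm]

theorem mem_B {j : S} {U : Set {s : S // s ≠ j}} {s : S} :
    s ∈ B j U ↔ s = j ∨ ∃ h : s ≠ j, (⟨s, h⟩ : {s : S // s ≠ j}) ∈ U := by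
  simp [B]

end Grid

/-! ### The hypotheses on the double cube as lattice inequalities. -/

section Conditions

open Function Classical

variable {S : Type w} [Finite S] {A : Type u} [Category.{v} A] [Abelian A] (x : DCube S A)
  (hx : ∀ j : Grid 2 S, Mono (res x (Grid.zero_le j)))

theorem transverse_of_admissible_two (h : Cube.Admissible (pull x two)) (p q : S → Fin 3)
    (M : Finset S) (i : S) (hi : i ∈ M) (hj : ∀ j, j ∉ M → p j ≠ 1) (hp : ∀ k ∈ M, p k = 0)
    (hq : ∀ k ∈ M, q k = 2) : Transverse (x.vertex hx) p q i (M.erase i) := by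
  have hp1 : ∀ s, p s ≠ 1 := fun s => by
    by_cases hs : s ∈ M
    · simp [hp s hs]
    · exact hj s hs
  have hU : ∀ k ∈ M, k ∉ {s | p s = 2} := fun k hk => by simp [hp k hk]
  have := (x.presentation hx two).admissible_iff.1 h (M.erase i) i {s | p s = 2} (by simp)
    (fun u hu hu' => hU u (Finset.mem_of_mem_erase hu') hu) (hU i hi)
  simp only [two_insert, two_setOf_eq_two hp1] at this
  unfold Transverse
  refine le_trans (inf_le_inf (le_of_eq ?_) (Finset.sup_mono_fun fun k hk => le_of_eq ?_))
    (this.trans (Finset.sup_mono_fun fun k hk => le_of_eq ?_))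
  · rw [hq i hi]
  · rw [hq k (Finset.mem_of_mem_erase hk)]
  · rw [hq i hi, hq k (Finset.mem_of_mem_erase hk)]

theorem transverse_of_admissible_back
    (h : ∀ T : Set S, T ≠ Set.univ → ∀ k : S, Cube.Admissible (Cube.back (pull x (e T)) k))
    (p q : S → Fin 3) (M : Finset S) (i : S) (hi : i ∈ M) (hj : ∃ j, j ∉ M ∧ p j = 1)
    (hpq : ∀ k ∈ M, (q k : ℕ) = p k + 1) : Transverse (x.vertex hx) p q i (M.erase i) := by
  obtain ⟨j, hjM, hpj⟩ := hj
  -- On `M` the starting value of each unit edge comes from `T` alone. Off `M`, values 1 and 2 use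
  -- `U`, and 2 also uses `T`. The value 1 at `j` comes from the backside face, so `j ∉ T` and `T`
  -- is proper.
  let T : Set S := {s | s ≠ j ∧ (s ∈ M ∧ p s = 1 ∨ s ∉ M ∧ p s = 2)}
  let U : Set {s : S // s ≠ j} := {s | s.1 ∉ M ∧ p s ≠ 0}
  have hT : T ≠ Set.univ := fun hT => (hT.symm ▸ Set.mem_univ j : j ∈ T).1 rfl
  have hne : ∀ k ∈ M, k ≠ j := fun k hk => ne_of_mem_of_not_mem hk hjM
  have hU : e T (B j U) = p := by
    funext s
    change chi (B j U) s + chi T s = p s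
    by_cases hs : s = j
    · subst hs
      simp [chi, mem_B, T, hpj]
    · by_cases hM : s ∈ M
      · have := hpq s hM
        have : p s = 0 ∨ p s = 1 := by omega
        rcases this with h | h <;> simp [chi, mem_B, T, U, hs, hM, h]
      · have : p s = 0 ∨ p s = 1 ∨ p s = 2 := by omega
        rcases this with h | h | h <;> simp [chi, mem_B, T, U, hs, hM, h]
  have hq : ∀ k ∈ M, 1 + chi T k = q k := fun k hk => by
    have := hpq k hk
    have h01 : p k = 0 ∧ q k = 1 ∨ p k = 1 ∧ q k = 2 := by omega
    rcases h01 with h | h <;> simp [chi, T, hne k hk, hk, h]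
  have := (x.presentation hx ((e T).comp (B j))).admissible_iff.1 (h T hT j)
    ((M.erase i).subtype (· ≠ j)) ⟨i, hne i hi⟩ U (by simp)
    (fun u hu hu' => hu.1 (Finset.mem_of_mem_erase (Finset.mem_subtype.1 hu')))
    (fun hu => hu.1 hi)
  unfold Transverse
  rw [← Finset.subtype_map_of_mem (p := (· ≠ j)) (s := M.erase i)
    fun k hk => hne k (Finset.mem_of_mem_erase hk), Finset.sup_map, Finset.sup_map]
  refine le_trans (inf_le_inf (le_of_eq ?_) (Finset.sup_mono_fun fun k hk => le_of_eq ?_))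
    (this.trans (Finset.sup_mono_fun fun k hk => le_of_eq ?_))
  · simp only [OrderHom.comp_coe, Function.comp_apply, B_insert]
    rw [e_apply_insert _ _ (hq i hi), hU]
  · have hkM := Finset.mem_of_mem_erase (Finset.mem_subtype.1 hk)
    simp only [OrderHom.comp_coe, Function.comp_apply, B_insert]
    rw [e_apply_insert _ _ (hq k.1 hkM), hU]
    rfl
  · have hkM := Finset.mem_of_mem_erase (Finset.mem_subtype.1 hk)
    simp only [OrderHom.comp_coe, Function.comp_apply, B_insert]
    rw [e_apply_insert _ _ (hq k.1 hkM), e_apply_insert _ _ (hq i hi), hU]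
    rfl

end Conditions

end DoubleCube

theorem theorem0p3 {S : Type w} [Finite S] {A : Type u} [Category.{v} A] [Abelian A]
    (x : DoubleCube.DCube S A)
    (h1 : DoubleCube.Cube.Admissible (DoubleCube.pull x DoubleCube.two))
    (h2 : ∀ (j j' : DoubleCube.Grid 2 S) (h : j < j'), Mono (DoubleCube.res x h.le))
    (h3 : 3 ≤ Nat.card S → ∀ T : Set S, T ≠ Set.univ → ∀ k : S,
      DoubleCube.Cube.Admissible
        (DoubleCube.Cube.back (DoubleCube.pull x (DoubleCube.e T)) k) ∧
      DoubleCube.Cube.Admissible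
        (DoubleCube.Cube.front (DoubleCube.pull x (DoubleCube.e T)) k)) :
    DoubleCube.Cube.Admissible (DoubleCube.pull x (DoubleCube.e Set.univ)) := by
  classical
  have hx : ∀ j : DoubleCube.Grid 2 S, Mono (DoubleCube.res x (DoubleCube.Grid.zero_le j)) := by
    intro j
    rcases (DoubleCube.Grid.zero_le j).eq_or_lt with rfl | h
    · exact inferInstanceAs (Mono (x.map (𝟙 _)))
    · exact h2 _ _ h
  have hs : ∀ (p q : S → Fin 3) (M : Finset S) (i : S), i ∈ M → (∃ j, j ∉ M ∧ p j = 1) →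
      (∀ k ∈ M, (q k : ℕ) = p k + 1) →
      DoubleCube.Transverse (x.vertex hx) p q i (M.erase i) := by
    intro p q M i hi hj hpq
    by_cases h : 3 ≤ Nat.card S
    · exact DoubleCube.transverse_of_admissible_back x hx (fun T hT k => (h3 h T hT k).1)
        p q M i hi hj hpq
    · have := Fintype.ofFinite S
      obtain ⟨j, hjM, -⟩ := hj
      have hcard := Finset.card_lt_univ_of_notMem hjM
      rw [Nat.card_eq_fintype_card] at h
      -- With at most two directions and `j` outside `M`, only `i` is left in `M`; the supremum is
      -- then empty and the inequality trivial.
      have hM : M.erase i = ∅ := by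
        rw [← Finset.card_eq_zero, Finset.card_erase_of_mem hi]
        omega
      rw [hM]
      exact inf_le_right
  rw [(x.presentation hx (DoubleCube.e Set.univ)).admissible_iff]
  intro L i U hi hU hiU
  have hc : ∀ k : S, 1 + DoubleCube.chi Set.univ k = 2 := fun k => by simp [DoubleCube.chi]
  have := DoubleCube.transverse_of_two (x.vertex_antitone hx) hs
    (DoubleCube.transverse_of_admissible_two x hx h1) (DoubleCube.e Set.univ U) (fun _ => 2)
    (insert i L) i (Finset.mem_insert_self _ _) (fun k hk => by
      have : k ∉ U := by
        rcases Finset.mem_insert.1 hk with rfl | hk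
        · exact hiU
        · exact fun h => hU k h hk
      rw [DoubleCube.e_apply]
      simp [DoubleCube.chi, this]) (fun _ _ => rfl)
  rw [Finset.erase_insert hi] at this
  simpa only [DoubleCube.Transverse, DoubleCube.e_apply_insert _ _ (hc _)] using this
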